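/- Let $(\bar M^{2m+1},\phi,\xi,\eta,g)$ be a Kenmotsu manifold: a smooth Riemannian manifold with Levi-Civita connection $\bar\nabla$, a smooth $(1,1)$-tensor field $\phi$, a smooth vector field $\xi$ and a smooth $1$-form $\eta$ such that $\phi\xi=0$, $\eta(\phi X)=0$, $\phi^2X=-X+\eta(X)\xi$, $g(\phi X,Y)=-g(X,\phi Y)$, $\eta(X)=g(X,\xi)$, $\eta(\xi)=1$, $g(\phi X,\phi Y)=g(X,Y)-\eta(X)\eta(Y)$, $\bar\nabla_X\xi=X-\eta(X)\xi$ and $(\bar\nabla_X\phi)Y=g(\phi X,Y)\xi-\eta(Y)\phi X$ for all vector fields $X,Y$. Let $(M_1,g_1)$, $(M_2,g_2)$ be Riemannian manifolds with $\dim M_2>0$, let $f>0$ be a smooth function on $M_1$, and let $M=M_1\times_fM_2$ (the manifold $M_1\times M_2$ with metric $g_1+f^2g_2$) be isometrically immersed in $\bar M$ so that $\xi$ is tangent to $M_1$. Suppose that $M$ is (1) a pointwise bi-slant submanifold: there are distributions $\mathcal D_1,\mathcal D_2$ on $M$ with $TM=\mathcal D_1\oplus\mathcal D_2\oplus\langle\xi\rangle$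 (orthogonal direct sum), $TM_1=\mathcal D_1\oplus\langle\xi\rangle$, $TM_2=\mathcal D_2$, $\phi(\mathcal D_1)\perp\mathcal D_2\oplus\langle\xi\rangle$, and functions $\theta_1,\theta_2$ on $M$ such that for $i=1,2$, every $p\in M$ and every non-zero $X\in\mathcal D_i(p)$ the angle between $\phi X$ and $\mathcal D_i(p)$ is $\theta_i(p)$; (2) proper: neither $\theta_1$ nor $\theta_2$ is identically $0$, identically $\pi/2$, or constant; (3) mixed totally geodesic: the second fundamental form $h$ of $M$ in $\bar M$ satisfies $h(X,Z)=0$ for all $X$ tangent to $M_1$ and $Z$ tangent to $M_2$. Then $\xi(\ln f)=1$ at every point of $M$. -/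

import Mathlib

open Bundle Set
open scoped Manifold ContDiff Topology InnerProductSpace

noncomputable section

namespace KenmotsuGeometry

section LeviCivita

variable {E : Type*} [NormedAddCommGroup E] [NormedSpace ℝ E]
  {H : Type*} [TopologicalSpace H] (I : ModelWithCorners ℝ E H)
  {M : Type*} [TopologicalSpace M] [ChartedSpace H M]
  [RiemannianBundle (fun x : M ↦ TangentSpace I x)]

/-- Half of the right-hand side of Koszul's formula, that is, the value of `g(∇_X Y, Z)` at `x`. -/
def koszul (X Y Z : Π x : M, TangentSpace I x) (x : M) : ℝ :=
  (d% (fun y ↦ inner ℝ (Y y) (Z y)) x (X x) + d% (fun y ↦ inner ℝ (X y) (Z y)) x (Y x)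
    - d% (fun y ↦ inner ℝ (X y) (Y y)) x (Z x)
    + inner ℝ (VectorField.mlieBracket I X Y x) (Z x)
    - inner ℝ (VectorField.mlieBracket I X Z x) (Y x)
    - inner ℝ (VectorField.mlieBracket I Y Z x) (X x)) / 2

variable {X X' Y Y' Z Z' : Π x : M, TangentSpace I x} {x : M} [IsManifold I ∞ M]

theorem tangent_ext {u v : TangentSpace I x}
    (h : ∀ Z : Π x : M, TangentSpace I x, MDiffAt (T% Z) x → inner ℝ u (Z x) = inner ℝ v (Z x)) :
    u = v := by
  refine ext_inner_right ℝ fun w ↦ ?_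
  have := h (FiberBundle.extend E w) (FiberBundle.mdifferentiableAt_extend I E w)
  simpa using this

variable [IsContMDiffRiemannianBundle I ∞ E (fun x : M ↦ TangentSpace I x)]

theorem mdifferentiableAt_inner (hY : MDiffAt (T% Y) x) (hZ : MDiffAt (T% Z) x) :
    MDiffAt (fun y ↦ inner ℝ (Y y) (Z y)) x :=
  MDifferentiableAt.inner_bundle (E := fun x : M ↦ TangentSpace I x) (IB := I) (F := E)
    (b := id) hY hZ

variable [FiniteDimensional ℝ E]

theorem koszul_smul_left {f : M → ℝ} (hf : MDiffAt f x) (hX : MDiffAt (T% X) x)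
    (hY : MDiffAt (T% Y) x) (hZ : MDiffAt (T% Z) x) :
    koszul I (f • X) Y Z x = f x * koszul I X Y Z x := by
  have h1 := mvfderiv_fun_mul hf (mdifferentiableAt_inner I hX hZ)
  have h2 := mvfderiv_fun_mul hf (mdifferentiableAt_inner I hX hY)
  simp only [koszul, Pi.smul_apply', inner_smul_left, conj_trivial, h1, h2,
    VectorField.mlieBracket_smul_left hf hX, add_apply, map_smul,
    smul_apply, smul_eq_mul, inner_add_left, inner_smul_right]
  rw [real_inner_comm (Z x) (X x), real_inner_comm (Y x) (X x)]
  ring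

theorem koszul_add_left (hX : MDiffAt (T% X) x) (hX' : MDiffAt (T% X') x)
    (hY : MDiffAt (T% Y) x) (hZ : MDiffAt (T% Z) x) :
    koszul I (X + X') Y Z x = koszul I X Y Z x + koszul I X' Y Z x := by
  have h1 := mvfderiv_fun_add (mdifferentiableAt_inner I hX hZ) (mdifferentiableAt_inner I hX' hZ)
  have h2 := mvfderiv_fun_add (mdifferentiableAt_inner I hX hY) (mdifferentiableAt_inner I hX' hY)
  simp only [koszul, Pi.add_apply, h1, h2,
    VectorField.mlieBracket_add_left hX hX', add_apply, map_add,
    inner_add_left, inner_add_right]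
  ring

theorem koszul_smul_right {f : M → ℝ} (hf : MDiffAt f x) (hX : MDiffAt (T% X) x)
    (hY : MDiffAt (T% Y) x) (hZ : MDiffAt (T% Z) x) :
    koszul I X Y (f • Z) x = f x * koszul I X Y Z x := by
  have h1 := mvfderiv_fun_mul hf (mdifferentiableAt_inner I hX hZ)
  have h2 := mvfderiv_fun_mul hf (mdifferentiableAt_inner I hY hZ)
  simp only [koszul, Pi.smul_apply', inner_smul_left, conj_trivial, h1, h2,
    VectorField.mlieBracket_smul_right hf hZ, add_apply, map_smul,
    smul_apply, smul_eq_mul, inner_add_left, inner_smul_right]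
  rw [real_inner_comm (Z x) (X x), real_inner_comm (Z x) (Y x)]
  ring

theorem koszul_add_right (hX : MDiffAt (T% X) x) (hZ' : MDiffAt (T% Z') x)
    (hY : MDiffAt (T% Y) x) (hZ : MDiffAt (T% Z) x) :
    koszul I X Y (Z + Z') x = koszul I X Y Z x + koszul I X Y Z' x := by
  have h1 := mvfderiv_fun_add (mdifferentiableAt_inner I hX hZ) (mdifferentiableAt_inner I hX hZ')
  have h2 := mvfderiv_fun_add (mdifferentiableAt_inner I hY hZ) (mdifferentiableAt_inner I hY hZ')
  simp only [koszul, Pi.add_apply, h1, h2,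
    VectorField.mlieBracket_add_right hZ hZ', add_apply, map_add,
    inner_add_left, inner_add_right]
  ring

theorem koszul_smul_middle {f : M → ℝ} (hf : MDiffAt f x) (hX : MDiffAt (T% X) x)
    (hY : MDiffAt (T% Y) x) (hZ : MDiffAt (T% Z) x) :
    koszul I X (f • Y) Z x = f x * koszul I X Y Z x + d% f x (X x) * inner ℝ (Y x) (Z x) := by
  have h1 := mvfderiv_fun_mul hf (mdifferentiableAt_inner I hY hZ)
  have h2 := mvfderiv_fun_mul hf (mdifferentiableAt_inner I hX hY)
  simp only [koszul, Pi.smul_apply', inner_smul_left, conj_trivial, h1, h2,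
    VectorField.mlieBracket_smul_right hf hY, VectorField.mlieBracket_smul_left hf hY,
    add_apply, map_smul,
    smul_apply, smul_eq_mul, inner_add_left, inner_smul_right]
  rw [real_inner_comm (Y x) (X x)]
  ring

theorem koszul_add_middle (hX : MDiffAt (T% X) x) (hY' : MDiffAt (T% Y') x)
    (hY : MDiffAt (T% Y) x) (hZ : MDiffAt (T% Z) x) :
    koszul I X (Y + Y') Z x = koszul I X Y Z x + koszul I X Y' Z x := by
  have h1 := mvfderiv_fun_add (mdifferentiableAt_inner I hY hZ) (mdifferentiableAt_inner I hY' hZ)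
  have h2 := mvfderiv_fun_add (mdifferentiableAt_inner I hX hY) (mdifferentiableAt_inner I hX hY')
  simp only [koszul, Pi.add_apply, h1, h2, VectorField.mlieBracket_add_left hY hY',
    VectorField.mlieBracket_add_right hY hY', add_apply, map_add,
    inner_add_left, inner_add_right]
  ring

variable (Y) in
/-- The bilinear form `(v, w) ↦ g(∇_v Y, w)` on the tangent space at `x`. -/
def koszulForm (hY : MDiffAt (T% Y) x) :
    TangentSpace I x →L[ℝ] TangentSpace I x →L[ℝ] ℝ :=
  TensorialAt.mkHom₂ (I := I) (F := E) (F' := E) (V := fun x : M ↦ TangentSpace I x)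
    (V' := fun x : M ↦ TangentSpace I x) (fun X Z ↦ koszul I X Y Z x) x
    (fun _ hZ ↦ ⟨fun hf hX ↦ koszul_smul_left I hf hX hY hZ,
      fun hX hX' ↦ koszul_add_left I hX hX' hY hZ⟩)
    (fun _ hX ↦ ⟨fun hf hZ ↦ koszul_smul_right I hf hX hY hZ,
      fun hZ hZ' ↦ koszul_add_right I hX hZ' hY hZ⟩)

theorem koszulForm_apply (hX : MDiffAt (T% X) x) (hY : MDiffAt (T% Y) x) (hZ : MDiffAt (T% Z) x) :
    koszulForm I Y hY (X x) (Z x) = koszul I X Y Z x :=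
  TensorialAt.mkHom₂_apply _ _ hX hZ

open Classical in
/-- The Levi-Civita derivative `leviCivitaFun I Y x v = ∇_v Y`, the unique vector such that
`g(∇_v Y, w)` is given by Koszul's formula for all `w` (with value `0` when `Y` is not
differentiable at `x`). -/
def leviCivitaFun (Y : Π x : M, TangentSpace I x) (x : M) :
    TangentSpace I x →L[ℝ] TangentSpace I x :=
  if hY : MDiffAt (T% Y) x then
    haveI : FiniteDimensional ℝ (TangentSpace I x) := inferInstanceAs (FiniteDimensional ℝ E)
    haveI : CompleteSpace (TangentSpace I x) := FiniteDimensional.complete ℝ _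
    LinearMap.toContinuousLinearMap
      { toFun v := (InnerProductSpace.toDual ℝ (TangentSpace I x)).symm (koszulForm I Y hY v)
        map_add' v w := by simp
        map_smul' c v := by simp }
  else 0

theorem inner_leviCivitaFun (hX : MDiffAt (T% X) x) (hY : MDiffAt (T% Y) x)
    (hZ : MDiffAt (T% Z) x) :
    inner ℝ (leviCivitaFun I Y x (X x)) (Z x) = koszul I X Y Z x := by
  rw [← koszulForm_apply I hX hY hZ]
  simp [leviCivitaFun, hY]

variable (M) in
/-- The Levi-Civita connection of a Riemannian manifold: `leviCivita I M Y x v` is `∇_v Y`. -/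
def leviCivita : CovariantDerivative I E (fun x : M ↦ TangentSpace I x) where
  toFun := leviCivitaFun I
  isCovariantDerivativeOnUniv :=
    { add := by
        intro Y Y' x hY hY' _
        ext v
        refine tangent_ext I fun Z hZ ↦ ?_
        have hX := FiberBundle.mdifferentiableAt_extend I E v
        have h1 := inner_leviCivitaFun I hX (mdifferentiableAt_add_section hY hY') hZ
        have h2 := inner_leviCivitaFun I hX hY hZ
        have h3 := inner_leviCivitaFun I hX hY' hZ
        have h4 := koszul_add_middle I hX hY' hY hZ
        simp only [FiberBundle.extend_apply_self] at h1 h2 h3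
        rw [add_apply, inner_add_left, h2, h3, ← h4]
        exact h1
      leibniz := by
        intro Y f x hY hf _
        ext v
        refine tangent_ext I fun Z hZ ↦ ?_
        have hX := FiberBundle.mdifferentiableAt_extend I E v
        have h1 := inner_leviCivitaFun I hX (hf.smul_section hY) hZ
        have h2 := inner_leviCivitaFun I hX hY hZ
        have h4 := koszul_smul_middle I hf hX hY hZ
        simp only [FiberBundle.extend_apply_self] at h1 h2 h4
        simp only [add_apply, smul_apply, ContinuousLinearMap.smulRight_apply, inner_add_left,
          inner_smul_left, conj_trivial, h2, ← h4]
        exact h1 }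

/-- Koszul's formula. -/
theorem inner_leviCivita (hX : MDiffAt (T% X) x) (hY : MDiffAt (T% Y) x)
    (hZ : MDiffAt (T% Z) x) :
    inner ℝ (leviCivita I M Y x (X x)) (Z x) = koszul I X Y Z x :=
  inner_leviCivitaFun I hX hY hZ

theorem leviCivita_torsion_free (hX : MDiffAt (T% X) x) (hY : MDiffAt (T% Y) x) :
    leviCivita I M Y x (X x) - leviCivita I M X x (Y x) = VectorField.mlieBracket I X Y x := by
  refine tangent_ext I fun Z hZ ↦ ?_
  rw [inner_sub_left, inner_leviCivita I hX hY hZ, inner_leviCivita I hY hX hZ]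
  have h1 : (fun y ↦ inner ℝ (Y y) (X y)) = fun y ↦ inner ℝ (X y) (Y y) := by
    ext y
    exact real_inner_comm _ _
  have h2 : VectorField.mlieBracket I Y X x = - VectorField.mlieBracket I X Y x :=
    VectorField.mlieBracket_swap_apply
  rw [koszul, koszul, h1, h2, inner_neg_left]
  ring

theorem leviCivita_metric (hX : MDiffAt (T% X) x) (hY : MDiffAt (T% Y) x)
    (hZ : MDiffAt (T% Z) x) :
    d% (fun y ↦ inner ℝ (Y y) (Z y)) x (X x) =
      inner ℝ (leviCivita I M Y x (X x)) (Z x) + inner ℝ (Y x) (leviCivita I M Z x (X x)) := by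
  rw [real_inner_comm _ (Y x), inner_leviCivita I hX hY hZ, inner_leviCivita I hX hZ hY]
  have h1 : (fun y ↦ inner ℝ (Z y) (Y y)) = fun y ↦ inner ℝ (Y y) (Z y) := by
    ext y
    exact real_inner_comm _ _
  have h2 : VectorField.mlieBracket I Z Y x = - VectorField.mlieBracket I Y Z x :=
    VectorField.mlieBracket_swap_apply
  rw [koszul, koszul, h1, h2, inner_neg_left]
  ring

end LeviCivita

section AlmostContact

variable {E : Type*} [NormedAddCommGroup E] [NormedSpace ℝ E]
  {H : Type*} [TopologicalSpace H] (I : ModelWithCorners ℝ E H)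
  (M : Type*) [TopologicalSpace M] [ChartedSpace H M] [IsManifold I ∞ M]
  [RiemannianBundle (fun x : M ↦ TangentSpace I x)]

/-- An almost contact metric structure `(φ, ξ, η, g)` on a Riemannian manifold `(M, g)`. -/
structure AlmostContactMetricStructure where
  /-- the `(1,1)` tensor field -/
  φ : Π x : M, TangentSpace I x →L[ℝ] TangentSpace I x
  /-- the structure vector field -/
  ξ : Π x : M, TangentSpace I x
  /-- the dual 1-form -/
  η : Π x : M, TangentSpace I x →L[ℝ] ℝ
  contMDiff_φ : ContMDiff I (I.prod 𝓘(ℝ, E →L[ℝ] E)) ∞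
    (fun x ↦ TotalSpace.mk' (E →L[ℝ] E)
      (E := fun x : M ↦ TangentSpace I x →L[ℝ] TangentSpace I x) x (φ x))
  contMDiff_ξ : ContMDiff I (I.prod 𝓘(ℝ, E)) ∞ (T% ξ)
  contMDiff_η : ContMDiff I (I.prod 𝓘(ℝ, E →L[ℝ] ℝ)) ∞
    (fun x ↦ TotalSpace.mk' (E →L[ℝ] ℝ)
      (E := fun x : M ↦ TangentSpace I x →L[ℝ] Bundle.Trivial M ℝ x) x (η x))
  φ_ξ : ∀ x, φ x (ξ x) = 0
  η_φ : ∀ x v, η x (φ x v) = 0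
  φ_φ : ∀ x v, φ x (φ x v) = -v + η x v • ξ x
  φ_skew : ∀ x v w, inner ℝ (φ x v) w = -inner ℝ v (φ x w)
  η_eq : ∀ x v, η x v = inner ℝ v (ξ x)
  η_ξ : ∀ x, η x (ξ x) = 1
  inner_φ_φ : ∀ x v w, inner ℝ (φ x v) (φ x w) = inner ℝ v w - η x v * η x w

variable {I M}
variable [FiniteDimensional ℝ E] [IsContMDiffRiemannianBundle I ∞ E (fun x : M ↦ TangentSpace I x)]

/-- An almost contact metric manifold is a Kenmotsu manifold if `∇_X ξ = X - η(X) ξ` and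
`(∇_X φ) Y = g(φ X, Y) ξ - η(Y) φ X`, where `∇` is the Levi-Civita connection and
`(∇_X φ) Y = ∇_X (φ Y) - φ (∇_X Y)`. -/
structure AlmostContactMetricStructure.IsKenmotsu (S : AlmostContactMetricStructure I M) :
    Prop where
  nabla_ξ : ∀ (x : M) (v : TangentSpace I x),
    leviCivita I M S.ξ x v = v - S.η x v • S.ξ x
  nabla_φ : ∀ Y : Π x : M, TangentSpace I x, ContMDiff I (I.prod 𝓘(ℝ, E)) ∞ (T% Y) →
    ∀ (x : M) (v : TangentSpace I x),
      leviCivita I M (fun y ↦ S.φ y (Y y)) x v - S.φ x (leviCivita I M Y x v) =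
        inner ℝ (S.φ x v) (Y x) • S.ξ x - S.η x (Y x) • S.φ x v

end AlmostContact

section Submanifold

variable {E : Type*} [NormedAddCommGroup E] [NormedSpace ℝ E] [FiniteDimensional ℝ E]
  {H : Type*} [TopologicalSpace H] {I : ModelWithCorners ℝ E H}
  {N : Type*} [TopologicalSpace N] [ChartedSpace H N] [IsManifold I ∞ N]
  [RiemannianBundle (fun x : N ↦ TangentSpace I x)]

instance (x : N) : FiniteDimensional ℝ (TangentSpace I x) :=
  inferInstanceAs (FiniteDimensional ℝ E)

variable {E' : Type*} [NormedAddCommGroup E'] [NormedSpace ℝ E']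
  {H' : Type*} [TopologicalSpace H'] (J : ModelWithCorners ℝ E' H') (I)
  {M : Type*} [TopologicalSpace M] [ChartedSpace H' M] [IsManifold J ∞ M]

/-- The tangent space of the immersed submanifold `ι : M → N` at the point `p` of `M`, as a
subspace of the tangent space of `N` at `ι p`. -/
def tangentImage (ι : M → N) (p : M) : Submodule ℝ (TangentSpace I (ι p)) :=
  LinearMap.range (mfderiv J I ι p).toLinearMap

/-- The vector field `Ybar` on `N` extends, near `p`, the vector field `Y` tangent to the immersed
submanifold `ι : M → N`; both fields are smooth near the relevant point. -/
structure IsLocalExtension (ι : M → N) (p : M) (Y : Π q : M, TangentSpace J q)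
    (Ybar : Π x : N, TangentSpace I x) : Prop where
  contMDiffAt : ContMDiffAt J (J.prod 𝓘(ℝ, E')) ∞ (T% Y) p
  contMDiffAt_bar : ContMDiffAt I (I.prod 𝓘(ℝ, E)) ∞ (T% Ybar) (ι p)
  eventually_eq : ∀ᶠ q in 𝓝 p, Ybar (ι q) = mfderiv J I ι q (Y q)

/-- The second fundamental form, by the Gauss formula: if `Ybar` is a local extension to `N` of a
vector field `Y` on `M`, then `h(v, Y)` is the component of `∇_v Ybar` normal to `M`. -/
def secondFundamentalForm [IsContMDiffRiemannianBundle I ∞ E (fun x : N ↦ TangentSpace I x)]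
    (ι : M → N) (p : M) (v : TangentSpace J p) (Ybar : Π x : N, TangentSpace I x) :
    TangentSpace I (ι p) :=
  (tangentImage I J ι p)ᗮ.starProjection (leviCivita I N Ybar (ι p) (mfderiv J I ι p v))

variable {I} in
/-- The angle between a tangent vector and a subspace of the tangent space: the angle between the
vector and its orthogonal projection (it is `π / 2` if the projection vanishes). -/
def angleWith {x : N} (v : TangentSpace I x) (D : Submodule ℝ (TangentSpace I x)) : ℝ :=
  InnerProductGeometry.angle v (D.starProjection v)

variable {I}

/-- A distribution `D` on the submanifold `ι : M → N` is pointwise slant with slant function `θ`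
if, for every `p` and every non-zero `v` in `D p`, the angle between `φ v` and `D p` is `θ p`. -/
def IsPointwiseSlant (S : AlmostContactMetricStructure I N) (ι : M → N)
    (D : Π p : M, Submodule ℝ (TangentSpace I (ι p))) (θ : M → ℝ) : Prop :=
  ∀ p, ∀ v ∈ D p, v ≠ 0 → angleWith (S.φ (ι p) v) (D p) = θ p

/-- The immersed submanifold `ι : M → N` is pointwise bi-slant, with distributions `D₁`, `D₂` and
slant functions `θ₁`, `θ₂`: the tangent space is the orthogonal direct sum of `D₁`, `D₂` and the
line spanned by `ξ`; `φ D₁` is orthogonal to `D₂` and `ξ`; and both distributions are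
pointwise slant. -/
structure IsPointwiseBiSlant (S : AlmostContactMetricStructure I N) (ι : M → N)
    (D₁ D₂ : Π p : M, Submodule ℝ (TangentSpace I (ι p))) (θ₁ θ₂ : M → ℝ) : Prop where
  orthogonal : ∀ p, D₁ p ⟂ D₂ p
  orthogonal_ξ₁ : ∀ p, D₁ p ⟂ ℝ ∙ S.ξ (ι p)
  orthogonal_ξ₂ : ∀ p, D₂ p ⟂ ℝ ∙ S.ξ (ι p)
  sup_eq : ∀ p, D₁ p ⊔ D₂ p ⊔ ℝ ∙ S.ξ (ι p) = tangentImage I J ι p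
  φ_orthogonal : ∀ p, (D₁ p).map (S.φ (ι p)).toLinearMap ⟂ D₂ p ⊔ ℝ ∙ S.ξ (ι p)
  slant₁ : IsPointwiseSlant S ι D₁ θ₁
  slant₂ : IsPointwiseSlant S ι D₂ θ₂

end Submanifold

/-- Properness of a pair of slant functions: neither of them is `0`, `π / 2` or constant. -/
def IsProperPair {M : Type*} (θ₁ θ₂ : M → ℝ) : Prop :=
  (θ₁ ≠ fun _ ↦ 0) ∧ (θ₁ ≠ fun _ ↦ Real.pi / 2) ∧ (¬ ∃ c, ∀ p, θ₁ p = c) ∧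
  (θ₂ ≠ fun _ ↦ 0) ∧ (θ₂ ≠ fun _ ↦ Real.pi / 2) ∧ (¬ ∃ c, ∀ p, θ₂ p = c)

section WarpedProduct

variable {E : Type*} [NormedAddCommGroup E] [NormedSpace ℝ E]
  {H : Type*} [TopologicalSpace H] (I : ModelWithCorners ℝ E H)
  {N : Type*} [TopologicalSpace N] [ChartedSpace H N]
  [RiemannianBundle (fun x : N ↦ TangentSpace I x)]
  {E₁ : Type*} [NormedAddCommGroup E₁] [NormedSpace ℝ E₁]
  {H₁ : Type*} [TopologicalSpace H₁] (I₁ : ModelWithCorners ℝ E₁ H₁)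
  {M₁ : Type*} [TopologicalSpace M₁] [ChartedSpace H₁ M₁]
  {E₂ : Type*} [NormedAddCommGroup E₂] [NormedSpace ℝ E₂]
  {H₂ : Type*} [TopologicalSpace H₂] (I₂ : ModelWithCorners ℝ E₂ H₂)
  {M₂ : Type*} [TopologicalSpace M₂] [ChartedSpace H₂ M₂]

/-- The immersion `ι : M₁ × M₂ → N` makes the warped product `M₁ ×_f M₂` a Riemannian submanifold
of `N`: `f` is smooth and positive on `M₁`, and the metric induced by `ι` is `g₁ + f² g₂`. -/
structure IsWarpedProductSubmanifold [RiemannianBundle (fun x : M₁ ↦ TangentSpace I₁ x)]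
    [RiemannianBundle (fun x : M₂ ↦ TangentSpace I₂ x)] (ι : M₁ × M₂ → N) (f : M₁ → ℝ) :
    Prop where
  contMDiff : ContMDiff (I₁.prod I₂) I ∞ ι
  injective : ∀ p, Function.Injective (mfderiv (I₁.prod I₂) I ι p)
  contMDiff_f : ContMDiff I₁ 𝓘(ℝ) ∞ f
  pos : ∀ a, 0 < f a
  metric : ∀ (p : M₁ × M₂) (v w : TangentSpace (I₁.prod I₂) p),
    inner ℝ (mfderiv (I₁.prod I₂) I ι p v) (mfderiv (I₁.prod I₂) I ι p w) =
      inner ℝ (mfderiv (I₁.prod I₂) I₁ Prod.fst p v) (mfderiv (I₁.prod I₂) I₁ Prod.fst p w) +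
      f p.1 ^ 2 *
        inner ℝ (mfderiv (I₁.prod I₂) I₂ Prod.snd p v) (mfderiv (I₁.prod I₂) I₂ Prod.snd p w)

/-- The tangent space of the factor `M₁`, inside the tangent space of `M₁ × M₂` at `p`. -/
def tangentFst (p : M₁ × M₂) : Submodule ℝ (TangentSpace (I₁.prod I₂) p) :=
  LinearMap.ker (mfderiv (I₁.prod I₂) I₂ Prod.snd p).toLinearMap

/-- The tangent space of the factor `M₂`, inside the tangent space of `M₁ × M₂` at `p`. -/
def tangentSnd (p : M₁ × M₂) : Submodule ℝ (TangentSpace (I₁.prod I₂) p) :=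
  LinearMap.ker (mfderiv (I₁.prod I₂) I₁ Prod.fst p).toLinearMap

/-- The tangent space of the factor `M₁`, inside the tangent space of `N` at `ι p`. -/
def tangentFstImage (ι : M₁ × M₂ → N) (p : M₁ × M₂) : Submodule ℝ (TangentSpace I (ι p)) :=
  (tangentFst I₁ I₂ p).map (mfderiv (I₁.prod I₂) I ι p).toLinearMap

/-- The tangent space of the factor `M₂`, inside the tangent space of `N` at `ι p`. -/
def tangentSndImage (ι : M₁ × M₂ → N) (p : M₁ × M₂) : Submodule ℝ (TangentSpace I (ι p)) :=
  (tangentSnd I₁ I₂ p).map (mfderiv (I₁.prod I₂) I ι p).toLinearMap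

variable [FiniteDimensional ℝ E] [IsManifold I ∞ N] [IsManifold I₁ ∞ M₁] [IsManifold I₂ ∞ M₂]

/-- `M₁ × M₂` is mixed totally geodesic in `N`: `h(X, Z) = 0` for all `X` tangent to `M₁` and all
vector fields `Z` tangent to `M₂`. -/
def IsMixedTotallyGeodesic [IsContMDiffRiemannianBundle I ∞ E (fun x : N ↦ TangentSpace I x)]
    (ι : M₁ × M₂ → N) : Prop :=
  ∀ (p : M₁ × M₂) (v : TangentSpace (I₁.prod I₂) p)
    (Z : Π q : M₁ × M₂, TangentSpace (I₁.prod I₂) q) (Zbar : Π x : N, TangentSpace I x),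
    v ∈ tangentFst I₁ I₂ p → (∀ q, Z q ∈ tangentSnd I₁ I₂ q) →
    IsLocalExtension I (I₁.prod I₂) ι p Z Zbar →
    secondFundamentalForm I (I₁.prod I₂) ι p v Zbar = 0

/-- `M₁ ×_f M₂` is a warped product pointwise bi-slant submanifold of `N` with `ξ` tangent to `M₁`
and slant functions `θ₁`, `θ₂`: it is a warped product submanifold and it is pointwise bi-slant for
distributions `D₁`, `D₂` with `T M₁ = D₁ ⊕ ⟨ξ⟩` and `T M₂ = D₂`. -/
structure IsWarpedProductPointwiseBiSlant [RiemannianBundle (fun x : M₁ ↦ TangentSpace I₁ x)]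
    [RiemannianBundle (fun x : M₂ ↦ TangentSpace I₂ x)] (S : AlmostContactMetricStructure I N)
    (ι : M₁ × M₂ → N) (f : M₁ → ℝ) (D₁ D₂ : Π p : M₁ × M₂, Submodule ℝ (TangentSpace I (ι p)))
    (θ₁ θ₂ : M₁ × M₂ → ℝ) : Prop where
  warped : IsWarpedProductSubmanifold I I₁ I₂ ι f
  biSlant : IsPointwiseBiSlant (I₁.prod I₂) S ι D₁ D₂ θ₁ θ₂
  tangentFst_eq : ∀ p, tangentFstImage I I₁ I₂ ι p = D₁ p ⊔ ℝ ∙ S.ξ (ι p)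
  tangentSnd_eq : ∀ p, tangentSndImage I I₁ I₂ ι p = D₂ p

end WarpedProduct

end KenmotsuGeometry

end

/-!
Let `Z` be a non-zero vector tangent to `M₂`. Since `ξ` is tangent to `M₁`, it is orthogonal to `Z`,
and the Kenmotsu identity `∇_Z ξ = Z - η(Z) ξ` gives `g(∇_Z ξ, Z) = g(Z, Z)`. On the other hand the
warped product metric forces `g(∇_Z ξ, Z) = ξ(ln f) g(Z, Z)`; dividing by `g(Z, Z)` gives the claim.

The second identity (`IsWarpedProductSubmanifold.inner_leviCivita_self`) holds for any field `X` of
the ambient manifold that is tangent to `M₁` along the submanifold. It is proved on the surface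
`σ(s, t) = ι (α s, β t)`, where `α` is a curve in `M₁` with initial velocity `X` and `β` a curve in
`M₂` with initial velocity `Z`. Along `t = 0` one has `g(∂ₜσ, ∂ₜσ) = f² K` with `K` constant, so its
logarithmic derivative is `2 X(ln f)`. The same derivative equals `2 g(∇_Z X, Z)`
(`hasDerivAt_inner_of_variation`): for a field `X` the form `2 g(∇_Z X, Z)` is the Lie derivative
`(L_X g)(Z, Z)` (`inner_leviCivita_self`), and the fields `X` and `∂ₛσ` agree at the origin, while
along `s = 0` their difference is orthogonal to `∂ₜσ`. Differentiating this orthogonality relation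
shows that the two are interchangeable in the computation
(`hasDerivAt_of_metric_variation`, carried out in a chart).
-/

noncomputable section

namespace KenmotsuGeometry

/-! ### Variation of a metric on a normed space -/

section FlatVariation

variable {E : Type*} [NormedAddCommGroup E] [NormedSpace ℝ E]

set_option synthInstance.maxHeartbeats 200000 in
/-- Let `G` be a metric and `X` a vector field on `E`, and let `Φ(s, t)` be a parametrised surface
with `∂ₛΦ = X` at the origin and `X - ∂ₛΦ` orthogonal to `∂ₜΦ` along the curve `s = 0`. Then the
`s`-derivative of `G(∂ₜΦ, ∂ₜΦ)` at the origin is `(L_X G)(∂ₜΦ, ∂ₜΦ)`, where `L_X` is the Lie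
derivative. -/
theorem hasDerivAt_of_metric_variation {G : E → E →L[ℝ] E →L[ℝ] ℝ} {X : E → E} {Φ : ℝ × ℝ → E}
    (hΦ : ContDiffAt ℝ 2 Φ (0, 0)) (hG : DifferentiableAt ℝ G (Φ (0, 0)))
    (hsymm : ∀ u w, G (Φ (0, 0)) u w = G (Φ (0, 0)) w u)
    (hX : DifferentiableAt ℝ X (Φ (0, 0))) (hX0 : fderiv ℝ Φ (0, 0) (1, 0) = X (Φ (0, 0)))
    (horth : ∀ᶠ t : ℝ in 𝓝 0, G (Φ (0, t)) (X (Φ (0, t)) - fderiv ℝ Φ (0, t) (1, 0))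
      (fderiv ℝ Φ (0, t) (0, 1)) = 0) :
    HasDerivAt (fun s : ℝ ↦ G (Φ (s, 0)) (fderiv ℝ Φ (s, 0) (0, 1)) (fderiv ℝ Φ (s, 0) (0, 1)))
      (fderiv ℝ G (Φ (0, 0)) (X (Φ (0, 0))) (fderiv ℝ Φ (0, 0) (0, 1)) (fderiv ℝ Φ (0, 0) (0, 1))
        + 2 * G (Φ (0, 0)) (fderiv ℝ X (Φ (0, 0)) (fderiv ℝ Φ (0, 0) (0, 1)))
          (fderiv ℝ Φ (0, 0) (0, 1))) 0 := by
  have hd : HasFDerivAt Φ (fderiv ℝ Φ (0, 0)) (0, 0) :=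
    (hΦ.differentiableAt (by norm_num)).hasFDerivAt
  have hd2 : HasFDerivAt (fderiv ℝ Φ) (fderiv ℝ (fderiv ℝ Φ) (0, 0)) (0, 0) :=
    ((hΦ.fderiv_right (m := 1) (by norm_num)).differentiableAt (by norm_num)).hasFDerivAt
  have hsym2 : fderiv ℝ (fderiv ℝ Φ) (0, 0) (1, 0) (0, 1)
      = fderiv ℝ (fderiv ℝ Φ) (0, 0) (0, 1) (1, 0) :=
    hΦ.isSymmSndFDerivAt (by simp) _ _
  have c1 : HasDerivAt (fun s : ℝ ↦ (s, (0 : ℝ))) (1, 0) 0 :=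
    (hasDerivAt_id (0 : ℝ)).prodMk (hasDerivAt_const _ _)
  have c2 : HasDerivAt (fun t : ℝ ↦ ((0 : ℝ), t)) (0, 1) 0 :=
    (hasDerivAt_const _ _).prodMk (hasDerivAt_id (0 : ℝ))
  have e1 : HasDerivAt (fun s : ℝ ↦ Φ (s, 0)) (X (Φ (0, 0))) 0 := by
    rw [← hX0]; exact hd.comp_hasDerivAt (f := fun s : ℝ ↦ (s, (0 : ℝ))) (0 : ℝ) c1
  have e2 : HasDerivAt (fun t : ℝ ↦ Φ (0, t)) (fderiv ℝ Φ (0, 0) (0, 1)) 0 :=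
    hd.comp_hasDerivAt (f := fun t : ℝ ↦ ((0 : ℝ), t)) (0 : ℝ) c2
  have f1 := hd2.comp_hasDerivAt (f := fun s : ℝ ↦ (s, (0 : ℝ))) (0 : ℝ) c1
  have f2 := hd2.comp_hasDerivAt (f := fun t : ℝ ↦ ((0 : ℝ), t)) (0 : ℝ) c2
  -- differentiate `g(X - ∂ₛΦ, ∂ₜΦ) = 0` at `t = 0`, where the first argument vanishes
  have key : G (Φ (0, 0)) (fderiv ℝ X (Φ (0, 0)) (fderiv ℝ Φ (0, 0) (0, 1))
      - fderiv ℝ (fderiv ℝ Φ) (0, 0) (0, 1) (1, 0)) (fderiv ℝ Φ (0, 0) (0, 1)) = 0 := by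
    have a1 : HasDerivAt (fun t : ℝ ↦ X (Φ (0, t)))
        (fderiv ℝ X (Φ (0, 0)) (fderiv ℝ Φ (0, 0) (0, 1))) 0 :=
      hX.hasFDerivAt.comp_hasDerivAt (0 : ℝ) e2
    have a2 := a1.sub (f2.clm_apply (hasDerivAt_const (0 : ℝ) ((1, 0) : ℝ × ℝ)))
    have a3 := f2.clm_apply (hasDerivAt_const (0 : ℝ) ((0, 1) : ℝ × ℝ))
    have a4 := hG.hasFDerivAt.comp_hasDerivAt (l := G) (f := fun t : ℝ ↦ Φ (0, t)) (0 : ℝ) e2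
    have a5 := (a4.clm_apply a2).clm_apply a3
    have a6 := a5.unique ((hasDerivAt_const (0 : ℝ) (0 : ℝ)).congr_of_eventuallyEq horth)
    simpa [hX0] using a6
  -- `key` replaces the mixed derivative of `Φ` in `∂ₛ (G(∂ₜΦ, ∂ₜΦ))` by the derivative of `X`
  have b1 := f1.clm_apply (hasDerivAt_const (0 : ℝ) ((0, 1) : ℝ × ℝ))
  have b2 := hG.hasFDerivAt.comp_hasDerivAt (l := G) (f := fun s : ℝ ↦ Φ (s, 0)) (0 : ℝ) e1
  have b3 := (b2.clm_apply b1).clm_apply b1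
  refine b3.congr_deriv ?_
  simp only [map_sub, sub_apply, sub_eq_zero] at key
  simp only [map_zero, add_zero, Function.comp_apply, add_apply, hsym2, key]
  rw [hsymm (fderiv ℝ Φ (0, 0) (0, 1))]
  ring

theorem lieBracketWithin_univ_of_eventuallyEq_const {V W W' : E → E} {x u : E}
    (hV : V =ᶠ[𝓝 x] fun _ ↦ u) (hW : W =ᶠ[𝓝 x] W') :
    VectorField.lieBracketWithin ℝ V W univ x = fderiv ℝ W' x u := by
  rw [VectorField.lieBracketWithin_univ, VectorField.lieBracket_eq]
  simp [hV.fderiv_eq, hW.fderiv_eq, hV.eq_of_nhds]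

end FlatVariation

/-! ### Vector fields in a chart -/

section Coordinates

variable {E : Type*} [NormedAddCommGroup E] [NormedSpace ℝ E]
  {H : Type*} [TopologicalSpace H] (I : ModelWithCorners ℝ E H)
  {N : Type*} [TopologicalSpace N] [ChartedSpace H N] [IsManifold I ∞ N]

/-- The vector field with constant coordinates `u` in the chart at `x₀`, with the junk value `0`
outside the domain of that chart. -/
def coordField (x₀ : N) (u : E) (y : N) : TangentSpace I y :=
  (trivializationAt E (TangentSpace I) x₀).symmL ℝ y u

/-- The vector field `X` read in the chart at `x₀`; only its values on the target of that chart are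
meaningful. -/
def fieldInChart (x₀ : N) (X : Π x : N, TangentSpace I x) (y : E) : E :=
  (trivializationAt E (TangentSpace I) x₀).continuousLinearMapAt ℝ ((extChartAt I x₀).symm y)
    (X ((extChartAt I x₀).symm y))

variable {I}

theorem contMDiffOn_coordField (x₀ : N) (u : E) :
    ContMDiffOn I (I.prod 𝓘(ℝ, E)) ∞ (T% (coordField I x₀ u)) (chartAt H x₀).source := by
  intro x hx
  have hx' : x ∈ (trivializationAt E (TangentSpace I) x₀).baseSet := by simpa using hx
  rw [(trivializationAt E (TangentSpace I) x₀).contMDiffWithinAt_section _ hx']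
  have : ContMDiffOn I 𝓘(ℝ, E) ∞ (fun _ : N ↦ u) (chartAt H x₀).source := contMDiffOn_const
  refine (this.congr fun y hy ↦ ?_) x hx
  have hy' : y ∈ (trivializationAt E (TangentSpace I) x₀).baseSet := by simpa using hy
  have := Trivialization.continuousLinearMapAt_symmL (R := ℝ)
    (trivializationAt E (TangentSpace I) x₀) hy' u
  rwa [Trivialization.continuousLinearMapAt_apply, Trivialization.coe_linearMapAt_of_mem _ hy']
    at this

/-- The trivialization at `x₀` is the identity over `x₀`, so the coordinate field of `u : E` takes
there the value `u`, read through the definitional unfolding of the tangent space at `x₀` to `E`. -/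
theorem coordField_self (x₀ : N) (u : E) : coordField I x₀ u x₀ = u := by
  rw [coordField, TangentBundle.symmL_trivializationAt (by simp),
    mfderivWithin_range_extChartAt_symm]
  rfl

theorem mdifferentiableAt_coordField (x₀ : N) (u : E) : MDiffAt (T% (coordField I x₀ u)) x₀ :=
  ((contMDiffOn_coordField x₀ u).contMDiffAt
    ((chartAt H x₀).open_source.mem_nhds (mem_chart_source H x₀))).mdifferentiableAt (by simp)

theorem fieldInChart_self (x₀ : N) (X : Π x : N, TangentSpace I x) :
    fieldInChart I x₀ X (extChartAt I x₀ x₀) = X x₀ := by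
  simp only [fieldInChart]
  rw [extChartAt_to_inv, TangentBundle.continuousLinearMapAt_trivializationAt (by simp),
    mfderiv_extChartAt_self]
  rfl

theorem fieldInChart_coordField {x₀ : N} (u : E) {y : E} (hy : y ∈ (extChartAt I x₀).target) :
    fieldInChart I x₀ (coordField I x₀ u) y = u := by
  have hy' : (extChartAt I x₀).symm y ∈ (trivializationAt E (TangentSpace I) x₀).baseSet := by
    simpa using (extChartAt I x₀).map_target hy
  exact Trivialization.continuousLinearMapAt_symmL (R := ℝ) _ hy' u

theorem mpullbackWithin_eq_fieldInChart {x₀ : N} (X : Π x : N, TangentSpace I x) {y : E}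
    (hy : y ∈ (extChartAt I x₀).target) :
    VectorField.mpullbackWithin 𝓘(ℝ, E) I (extChartAt I x₀).symm X (range I) y =
      fieldInChart I x₀ X y := by
  have hy' : (extChartAt I x₀).symm y ∈ (chartAt H x₀).source := by
    simpa using (extChartAt I x₀).map_target hy
  rw [VectorField.mpullbackWithin_apply, fieldInChart,
    TangentBundle.continuousLinearMapAt_trivializationAt hy',
    ContinuousLinearMap.inverse_eq (mfderivWithin_extChartAt_symm_comp_mfderiv_extChartAt hy)
      (mfderiv_extChartAt_comp_mfderivWithin_extChartAt_symm hy)]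
  rfl

theorem coordField_fieldInChart {x₀ x : N} (hx : x ∈ (chartAt H x₀).source)
    (X : Π x : N, TangentSpace I x) :
    coordField I x₀ (fieldInChart I x₀ X (extChartAt I x₀ x)) x = X x := by
  have h : (extChartAt I x₀).symm (extChartAt I x₀ x) = x :=
    (extChartAt I x₀).left_inv (by simpa using hx)
  rw [fieldInChart, h]
  exact Trivialization.symmL_continuousLinearMapAt (R := ℝ) _ (by simpa using hx) (X x)

theorem coordField_mfderiv_extChartAt {x₀ x : N} (hx : x ∈ (chartAt H x₀).source)
    (v : TangentSpace I x) :
    coordField I x₀ (mfderiv I 𝓘(ℝ, E) (extChartAt I x₀) x v) x = v := by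
  rw [← TangentBundle.continuousLinearMapAt_trivializationAt hx]
  exact Trivialization.symmL_continuousLinearMapAt (R := ℝ) _ (by simpa using hx) v

/-- A velocity of `σ`, computed in the chart, represents the corresponding velocity in `N`. -/
theorem coordField_fderiv {σ : ℝ × ℝ → N} {x₀ : N} {q : ℝ × ℝ}
    (hσ : MDifferentiableAt 𝓘(ℝ, ℝ × ℝ) I σ q) (hq : σ q ∈ (chartAt H x₀).source) (h : ℝ × ℝ) :
    coordField I x₀ (fderiv ℝ (fun q ↦ extChartAt I x₀ (σ q)) q h) (σ q) =
      mfderiv 𝓘(ℝ, ℝ × ℝ) I σ q h := by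
  have h1 := mfderiv_comp_apply q (mdifferentiableAt_extChartAt (I := I) hq) hσ h
  rw [← mfderiv_eq_fderiv]
  exact (congrArg (fun w : E ↦ coordField I x₀ w (σ q)) h1).trans
    (coordField_mfderiv_extChartAt hq _)

variable [I.Boundaryless]

theorem differentiableAt_fieldInChart {x₀ : N} {X : Π x : N, TangentSpace I x}
    (hX : MDiffAt (T% X) x₀) :
    DifferentiableAt ℝ (fieldInChart I x₀ X) (extChartAt I x₀ x₀) := by
  have h := (mdifferentiableAt_section I X).1 hX
  have h' := (mdifferentiableWithinAt_univ.2 h).differentiableWithinAt_comp_extChartAt_symm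
  simp only [preimage_univ, univ_inter, I.range_eq_univ, differentiableWithinAt_univ] at h'
  refine h'.congr_of_eventuallyEq ?_
  filter_upwards [extChartAt_target_mem_nhds (I := I) x₀] with y hy
  have hy' : (extChartAt I x₀).symm y ∈ (trivializationAt E (TangentSpace I) x₀).baseSet := by
    simpa using (extChartAt I x₀).map_target hy
  simp only [fieldInChart, Function.comp_apply]
  rw [Trivialization.continuousLinearMapAt_apply, Trivialization.coe_linearMapAt_of_mem _ hy']

/-- In the chart, one of the two fields is constant, so the bracket reduces to a directional
derivative. -/
theorem mlieBracket_coordField (x₀ : N) (u : E) (X : Π x : N, TangentSpace I x) :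
    VectorField.mlieBracket I (coordField I x₀ u) X x₀ =
      fderiv ℝ (fieldInChart I x₀ X) (extChartAt I x₀ x₀) u := by
  have hX : VectorField.mpullbackWithin 𝓘(ℝ, E) I (extChartAt I x₀).symm X (range I)
      =ᶠ[𝓝 (extChartAt I x₀ x₀)] fieldInChart I x₀ X := by
    filter_upwards [extChartAt_target_mem_nhds (I := I) x₀] with y hy
    exact mpullbackWithin_eq_fieldInChart X hy
  have hu : VectorField.mpullbackWithin 𝓘(ℝ, E) I (extChartAt I x₀).symm (coordField I x₀ u)
      (range I) =ᶠ[𝓝 (extChartAt I x₀ x₀)] fun _ ↦ u := by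
    filter_upwards [extChartAt_target_mem_nhds (I := I) x₀] with y hy
    rw [mpullbackWithin_eq_fieldInChart _ hy, fieldInChart_coordField u hy]
  have key : VectorField.lieBracketWithin ℝ
      (VectorField.mpullbackWithin 𝓘(ℝ, E) I (extChartAt I x₀).symm (coordField I x₀ u) (range I))
      (VectorField.mpullbackWithin 𝓘(ℝ, E) I (extChartAt I x₀).symm X (range I))
      ((extChartAt I x₀).symm ⁻¹' univ ∩ range I) (extChartAt I x₀ x₀) =
      fderiv ℝ (fieldInChart I x₀ X) (extChartAt I x₀ x₀) u := by
    have hr : ((extChartAt I x₀).symm ⁻¹' univ ∩ range I) = univ := by simp [I.range_eq_univ]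
    rw [hr]
    exact lieBracketWithin_univ_of_eventuallyEq_const hu hX
  rw [← VectorField.mlieBracketWithin_univ, VectorField.mlieBracketWithin_apply, key,
    mfderiv_extChartAt_self]
  change (ContinuousLinearMap.id ℝ E).inverse _ = _
  rw [ContinuousLinearMap.inverse_id]
  rfl

end Coordinates

/-! ### The Riemannian metric and the Levi-Civita connection in a chart -/

section MetricInChart

variable {E : Type*} [NormedAddCommGroup E] [NormedSpace ℝ E]
  {H : Type*} [TopologicalSpace H] {I : ModelWithCorners ℝ E H}
  {N : Type*} [TopologicalSpace N] [ChartedSpace H N] [IsManifold I ∞ N]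
  [RiemannianBundle (fun x : N ↦ TangentSpace I x)]

variable (I) in
/-- The Riemannian metric read in the chart at `x₀`, as a field of bilinear forms on the model
space. -/
def metricInChart (x₀ : N) (y : E) : E →L[ℝ] E →L[ℝ] ℝ :=
  (innerSL ℝ (E := TangentSpace I ((extChartAt I x₀).symm y))).bilinearComp
    ((trivializationAt E (TangentSpace I) x₀).symmL ℝ ((extChartAt I x₀).symm y))
    ((trivializationAt E (TangentSpace I) x₀).symmL ℝ ((extChartAt I x₀).symm y))

theorem metricInChart_extChartAt {x₀ x : N} (hx : x ∈ (chartAt H x₀).source) (u w : E) :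
    metricInChart I x₀ (extChartAt I x₀ x) u w
      = inner ℝ (coordField I x₀ u x) (coordField I x₀ w x) := by
  have h : (extChartAt I x₀).symm (extChartAt I x₀ x) = x :=
    (extChartAt I x₀).left_inv (by simpa using hx)
  rw [metricInChart, h]
  rfl

theorem metricInChart_symm (x₀ : N) (y u w : E) :
    metricInChart I x₀ y u w = metricInChart I x₀ y w u :=
  real_inner_comm (F := TangentSpace I ((extChartAt I x₀).symm y)) _ _

variable [I.Boundaryless] [FiniteDimensional ℝ E]
  [IsContMDiffRiemannianBundle I ∞ E (fun x : N ↦ TangentSpace I x)]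

theorem differentiableAt_metricInChart (x₀ : N) :
    DifferentiableAt ℝ (metricInChart I x₀) (extChartAt I x₀ x₀) := by
  suffices h : ContDiffOn ℝ ∞ (metricInChart I x₀) (extChartAt I x₀).target from
    (h.contDiffAt (extChartAt_target_mem_nhds x₀)).differentiableAt (by simp)
  refine contDiffOn_clm_apply.2 fun u ↦ contDiffOn_clm_apply.2 fun w ↦ ?_
  have h : ContMDiffOn I 𝓘(ℝ) ∞
      (fun x ↦ inner ℝ (coordField I x₀ u x) (coordField I x₀ w x)) (chartAt H x₀).source :=
    ContMDiffOn.inner_bundle (E := fun x : N ↦ TangentSpace I x) (IB := I) (F := E) (b := id)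
      (contMDiffOn_coordField x₀ u) (contMDiffOn_coordField x₀ w)
  exact contMDiffOn_iff_contDiffOn.1
    (h.comp (contMDiffOn_extChartAt_symm x₀) fun y hy ↦ by
      simpa using (extChartAt I x₀).map_target hy)

theorem mvfderiv_inner_coordField (x₀ : N) (u v : E) :
    mvfderiv I (fun x : N ↦ inner ℝ (coordField I x₀ u x) (coordField I x₀ u x)) x₀ v =
      fderiv ℝ (metricInChart I x₀) (extChartAt I x₀ x₀) v u u := by
  have h1 : HasFDerivAt (fun y ↦ metricInChart I x₀ y u u)
      (((fderiv ℝ (metricInChart I x₀) (extChartAt I x₀ x₀)).flip u).flip u)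
      (extChartAt I x₀ x₀) := by
    simpa using ((differentiableAt_metricInChart (I := I) x₀).hasFDerivAt.clm_apply
      (hasFDerivAt_const u _)).clm_apply (hasFDerivAt_const u _)
  have h2 := h1.hasMFDerivAt.comp x₀
    (mdifferentiableAt_extChartAt (I := I) (mem_chart_source H x₀)).hasMFDerivAt
  have h3 := h2.congr_of_eventuallyEq
    (f₁ := fun x : N ↦ inner ℝ (coordField I x₀ u x) (coordField I x₀ u x)) (by
      filter_upwards [(chartAt H x₀).open_source.mem_nhds (mem_chart_source H x₀)] with x hx
      exact (metricInChart_extChartAt hx u u).symm)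
  have h4 : mvfderiv I (fun x : N ↦ inner ℝ (coordField I x₀ u x) (coordField I x₀ u x)) x₀ v = _ :=
    congrFun (congrArg DFunLike.coe h3.mfderiv) v
  rw [h4, mfderiv_extChartAt_self]
  rfl

/-- The symmetric part of `∇X` is half the Lie derivative of the metric: the right-hand side is
`(L_X g)(u, u)` computed in the chart. It is Koszul's formula for the coordinate field of `u`, `X`
and the coordinate field of `u`. -/
theorem inner_leviCivita_self {x₀ : N} {X : Π x : N, TangentSpace I x} (hX : MDiffAt (T% X) x₀)
    (u : E) :
    2 * inner ℝ (leviCivita I N X x₀ (coordField I x₀ u x₀)) (coordField I x₀ u x₀) =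
      fderiv ℝ (metricInChart I x₀) (extChartAt I x₀ x₀)
          (fieldInChart I x₀ X (extChartAt I x₀ x₀)) u u +
        2 * metricInChart I x₀ (extChartAt I x₀ x₀)
          (fderiv ℝ (fieldInChart I x₀ X) (extChartAt I x₀ x₀) u) u := by
  have hu := mdifferentiableAt_coordField (I := I) x₀ u
  have h1 : (fun y ↦ inner ℝ (coordField I x₀ u y) (X y)) =
      fun y ↦ inner ℝ (X y) (coordField I x₀ u y) := by
    ext y
    exact real_inner_comm _ _
  have h2 : VectorField.mlieBracket I X (coordField I x₀ u) x₀ =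
      -VectorField.mlieBracket I (coordField I x₀ u) X x₀ :=
    VectorField.mlieBracket_swap_apply
  have h3 : VectorField.mlieBracket I (coordField I x₀ u) X x₀ =
      coordField I x₀ (fderiv ℝ (fieldInChart I x₀ X) (extChartAt I x₀ x₀) u) x₀ := by
    rw [mlieBracket_coordField, coordField_self]
  have h4 := mvfderiv_inner_coordField (I := I) x₀ u
    (fieldInChart I x₀ X (extChartAt I x₀ x₀))
  have h5 : mvfderiv I (fun x : N ↦ inner ℝ (coordField I x₀ u x) (coordField I x₀ u x)) x₀
      (X x₀) = _ := (congrArg _ (fieldInChart_self x₀ X).symm).trans h4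
  rw [inner_leviCivita I hu hX hu, koszul, h1, h2, VectorField.mlieBracket_self,
    inner_neg_left, Pi.zero_apply, inner_zero_left,
    metricInChart_extChartAt (mem_chart_source H x₀), h5, h3]
  ring

end MetricInChart

/-! ### Variation of the metric along a parametrised surface -/

section Variation

variable {E : Type*} [NormedAddCommGroup E] [NormedSpace ℝ E] [FiniteDimensional ℝ E]
  {H : Type*} [TopologicalSpace H] {I : ModelWithCorners ℝ E H} [I.Boundaryless]
  {N : Type*} [TopologicalSpace N] [ChartedSpace H N] [IsManifold I ∞ N]
  [RiemannianBundle (fun x : N ↦ TangentSpace I x)]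
  [IsContMDiffRiemannianBundle I ∞ E (fun x : N ↦ TangentSpace I x)]

variable (I) in
/-- The velocity field `∂ₛσ` of a parametrised surface `σ(s, t)`. -/
def dFst (σ : ℝ × ℝ → N) (q : ℝ × ℝ) : TangentSpace I (σ q) :=
  mfderiv 𝓘(ℝ, ℝ × ℝ) I σ q ((1, 0) : ℝ × ℝ)

variable (I) in
/-- The velocity field `∂ₜσ` of a parametrised surface `σ(s, t)`. -/
def dSnd (σ : ℝ × ℝ → N) (q : ℝ × ℝ) : TangentSpace I (σ q) :=
  mfderiv 𝓘(ℝ, ℝ × ℝ) I σ q ((0, 1) : ℝ × ℝ)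

/-- If `∂ₛσ = X` at the origin and `X - ∂ₛσ` is orthogonal to `∂ₜσ` along the curve `s = 0`, then
the `s`-derivative of `g(∂ₜσ, ∂ₜσ)` at the origin is `2 g(∇_{∂ₜσ} X, ∂ₜσ)`. The field `X` need not be
tangent to the surface away from the origin. -/
theorem hasDerivAt_inner_of_variation {σ : ℝ × ℝ → N} {X : Π x : N, TangentSpace I x}
    (hσ : ContMDiffAt 𝓘(ℝ, ℝ × ℝ) I 2 σ (0, 0)) (hX : MDiffAt (T% X) (σ (0, 0)))
    (hX0 : dFst I σ (0, 0) = X (σ (0, 0)))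
    (horth : ∀ᶠ t : ℝ in 𝓝 0, inner ℝ (X (σ (0, t)) - dFst I σ (0, t)) (dSnd I σ (0, t)) = 0) :
    HasDerivAt (fun s : ℝ ↦ inner ℝ (dSnd I σ (s, 0)) (dSnd I σ (s, 0)))
      (2 * inner ℝ (leviCivita I N X (σ (0, 0)) (dSnd I σ (0, 0))) (dSnd I σ (0, 0))) 0 := by
  set x₀ := σ (0, 0) with hx₀
  set Φ : ℝ × ℝ → E := fun q ↦ extChartAt I x₀ (σ q) with hΦ
  have hΦ2 : ContDiffAt ℝ 2 Φ (0, 0) := by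
    refine contMDiffAt_iff_contDiffAt.1 ?_
    exact (contMDiffAt_extChartAt (n := 2) (x := x₀)).comp (x := ((0 : ℝ), (0 : ℝ))) hσ
  have hev : ∀ᶠ q in 𝓝 ((0 : ℝ), (0 : ℝ)), σ q ∈ (chartAt H x₀).source ∧
      ∀ h, coordField I x₀ (fderiv ℝ Φ q h) (σ q) = mfderiv 𝓘(ℝ, ℝ × ℝ) I σ q h := by
    filter_upwards [(contMDiffAt_iff_contMDiffAt_nhds (by simp)).1 hσ,
      hσ.continuousAt.preimage_mem_nhds
      ((chartAt H x₀).open_source.mem_nhds (mem_chart_source H x₀))] with q h1 h2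
    exact ⟨h2, coordField_fderiv (h1.mdifferentiableAt (by simp)) h2⟩
  have c1 : ContinuousAt (fun s : ℝ ↦ (s, (0 : ℝ))) 0 := by fun_prop
  have c2 : ContinuousAt (fun t : ℝ ↦ ((0 : ℝ), t)) 0 := by fun_prop
  obtain ⟨h0, h0'⟩ := hev.self_of_nhds
  have main := hasDerivAt_of_metric_variation (G := metricInChart I x₀)
    (X := fieldInChart I x₀ X) hΦ2 (differentiableAt_metricInChart x₀) (metricInChart_symm x₀ _)
    (differentiableAt_fieldInChart hX) ?_ ?_
  · refine HasDerivAt.congr_of_eventuallyEq (main.congr_deriv ?_) ?_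
    · refine (inner_leviCivita_self hX _).symm.trans ?_
      rw [h0']
      rfl
    · filter_upwards [c1.eventually hev] with s hs
      rw [metricInChart_extChartAt hs.1, hs.2]
      rfl
  · have e1 : fderiv ℝ Φ (0, 0) (1, 0) = coordField I x₀ (fderiv ℝ Φ (0, 0) (1, 0)) x₀ :=
      (coordField_self _ _).symm
    rw [e1, h0']
    exact hX0.trans (fieldInChart_self x₀ X).symm
  · filter_upwards [c2.eventually hev, horth] with t ht h
    rw [metricInChart_extChartAt ht.1, ht.2]
    have e2 : coordField I x₀ (fieldInChart I x₀ X (Φ (0, t)) - fderiv ℝ Φ (0, t) (1, 0))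
        (σ (0, t)) = X (σ (0, t)) - dFst I σ (0, t) := by
      rw [coordField, map_sub]
      exact congrArg₂ _ (coordField_fieldInChart ht.1 X) (ht.2 _)
    rw [e2]
    exact h

end Variation

/-! ### Curves in a product manifold -/

section Curves

variable {E : Type*} [NormedAddCommGroup E] [NormedSpace ℝ E]
  {H : Type*} [TopologicalSpace H] {I : ModelWithCorners ℝ E H}
  {M : Type*} [TopologicalSpace M] [ChartedSpace H M]

/-- Every tangent vector `v` at `a` is the initial velocity of a curve that is smooth at `0`. The
equality of velocities is stated in the model space `E`, to which every tangent space unfolds, so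
that no transport along `α 0 = a` is needed. -/
theorem exists_curve [I.Boundaryless] [IsManifold I ∞ M] (a : M) (v : E) :
    ∃ α : ℝ → M, ContMDiffAt 𝓘(ℝ) I ∞ α 0 ∧
    α 0 = a ∧ mfderiv 𝓘(ℝ) I α 0 (1 : ℝ) = v := by
  have hl : HasDerivAt (fun s : ℝ ↦ extChartAt I a a + s • v) v 0 := by
    simpa using ((hasDerivAt_id (0 : ℝ)).smul_const v).const_add (extChartAt I a a)
  have h0 : extChartAt I a a + (0 : ℝ) • v = extChartAt I a a := by simp
  have hs : ContMDiffAt 𝓘(ℝ, E) I ∞ (extChartAt I a).symm (extChartAt I a a + (0 : ℝ) • v) := by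
    rw [h0]
    exact (contMDiffOn_extChartAt_symm a).contMDiffAt (extChartAt_target_mem_nhds a)
  have hc : ContMDiffAt 𝓘(ℝ) 𝓘(ℝ, E) ∞ (fun s : ℝ ↦ extChartAt I a a + s • v) 0 :=
    ContDiffAt.contMDiffAt (by fun_prop)
  refine ⟨fun s ↦ (extChartAt I a).symm (extChartAt I a a + s • v),
    ContMDiffAt.comp (0 : ℝ) hs hc, by simp, ?_⟩
  have h1 := mfderiv_comp_apply (0 : ℝ) (hs.mdifferentiableAt (by simp))
    (hc.mdifferentiableAt (by simp)) (1 : ℝ)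
  have h2 : mfderiv 𝓘(ℝ) 𝓘(ℝ, E) (fun s : ℝ ↦ extChartAt I a a + s • v) 0 (1 : ℝ) = v := by
    rw [mfderiv_eq_fderiv]
    exact hl.deriv
  have h3 : mfderiv 𝓘(ℝ, E) I (extChartAt I a).symm (extChartAt I a a + (0 : ℝ) • v) =
      ContinuousLinearMap.id ℝ E := by
    rw [h0, ← mfderivWithin_univ, ← I.range_eq_univ]
    exact mfderivWithin_range_extChartAt_symm
  refine h1.trans ?_
  rw [h2]
  exact DFunLike.congr_fun (F := E →L[ℝ] E) h3 v

variable {E' : Type*} [NormedAddCommGroup E'] [NormedSpace ℝ E']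
  {H' : Type*} [TopologicalSpace H'] {I' : ModelWithCorners ℝ E' H'}
  {M' : Type*} [TopologicalSpace M'] [ChartedSpace H' M']

theorem mdifferentiableAt_prodCurve {α : ℝ → M} {β : ℝ → M'} {q : ℝ × ℝ}
    (hα : MDifferentiableAt 𝓘(ℝ) I α q.1) (hβ : MDifferentiableAt 𝓘(ℝ) I' β q.2) :
    MDifferentiableAt 𝓘(ℝ, ℝ × ℝ) (I.prod I') (fun q : ℝ × ℝ ↦ (α q.1, β q.2)) q :=
  (hα.comp q (contDiff_fst.contMDiff.mdifferentiable one_ne_zero q)).prodMk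
    (hβ.comp q (contDiff_snd.contMDiff.mdifferentiable one_ne_zero q))

theorem mfderiv_prodCurve {α : ℝ → M} {β : ℝ → M'} {q : ℝ × ℝ}
    (hα : MDifferentiableAt 𝓘(ℝ) I α q.1) (hβ : MDifferentiableAt 𝓘(ℝ) I' β q.2) (h : ℝ × ℝ) :
    mfderiv 𝓘(ℝ, ℝ × ℝ) (I.prod I') (fun q : ℝ × ℝ ↦ (α q.1, β q.2)) q h =
      (mfderiv 𝓘(ℝ) I α q.1 h.1, mfderiv 𝓘(ℝ) I' β q.2 h.2) := by
  have h1 : MDifferentiableAt 𝓘(ℝ, ℝ × ℝ) 𝓘(ℝ) (Prod.fst : ℝ × ℝ → ℝ) q :=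
    contDiff_fst.contMDiff.mdifferentiable one_ne_zero q
  have h2 : MDifferentiableAt 𝓘(ℝ, ℝ × ℝ) 𝓘(ℝ) (Prod.snd : ℝ × ℝ → ℝ) q :=
    contDiff_snd.contMDiff.mdifferentiable one_ne_zero q
  have e1 := mfderiv_comp_apply q hα h1 h
  have e2 := mfderiv_comp_apply q hβ h2 h
  rw [mfderiv_eq_fderiv, fderiv_fst] at e1
  rw [mfderiv_eq_fderiv, fderiv_snd] at e2
  have e3 := mfderiv_prodMk (hα.comp q h1) (hβ.comp q h2)
  exact (DFunLike.congr_fun (F := ℝ × ℝ →L[ℝ] E × E') e3 h).trans (congrArg₂ Prod.mk e1 e2)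

end Curves

/-! ### Warped product submanifolds -/

section WarpedProductSubmanifold

variable {E : Type*} [NormedAddCommGroup E] [NormedSpace ℝ E]
  {H : Type*} [TopologicalSpace H] {I : ModelWithCorners ℝ E H}
  {N : Type*} [TopologicalSpace N] [ChartedSpace H N]
  [RiemannianBundle (fun x : N ↦ TangentSpace I x)]
  {E₁ : Type*} [NormedAddCommGroup E₁] [NormedSpace ℝ E₁]
  {H₁ : Type*} [TopologicalSpace H₁] {I₁ : ModelWithCorners ℝ E₁ H₁}
  {M₁ : Type*} [TopologicalSpace M₁] [ChartedSpace H₁ M₁]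
  {E₂ : Type*} [NormedAddCommGroup E₂] [NormedSpace ℝ E₂]
  {H₂ : Type*} [TopologicalSpace H₂] {I₂ : ModelWithCorners ℝ E₂ H₂}
  {M₂ : Type*} [TopologicalSpace M₂] [ChartedSpace H₂ M₂]

theorem mem_tangentFst_iff {p : M₁ × M₂} {v : TangentSpace (I₁.prod I₂) p} :
    v ∈ tangentFst I₁ I₂ p ↔ v.2 = 0 := by
  rw [tangentFst, LinearMap.mem_ker]
  change mfderiv (I₁.prod I₂) I₂ Prod.snd p v = 0 ↔ _
  rw [mfderiv_snd]
  rfl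

theorem mem_tangentSnd_iff {p : M₁ × M₂} {v : TangentSpace (I₁.prod I₂) p} :
    v ∈ tangentSnd I₁ I₂ p ↔ v.1 = 0 := by
  rw [tangentSnd, LinearMap.mem_ker]
  change mfderiv (I₁.prod I₂) I₁ Prod.fst p v = 0 ↔ _
  rw [mfderiv_fst]
  rfl

variable [RiemannianBundle (fun x : M₁ ↦ TangentSpace I₁ x)]
  [RiemannianBundle (fun x : M₂ ↦ TangentSpace I₂ x)] {ι : M₁ × M₂ → N} {f : M₁ → ℝ}

theorem IsWarpedProductSubmanifold.inner_eq_zero (hW : IsWarpedProductSubmanifold I I₁ I₂ ι f)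
    {p : M₁ × M₂} {v w : TangentSpace (I₁.prod I₂) p} (hv : v ∈ tangentFst I₁ I₂ p)
    (hw : w ∈ tangentSnd I₁ I₂ p) :
    inner ℝ (mfderiv (I₁.prod I₂) I ι p v) (mfderiv (I₁.prod I₂) I ι p w) = 0 := by
  have hv' : mfderiv (I₁.prod I₂) I₂ Prod.snd p v = 0 := hv
  have hw' : mfderiv (I₁.prod I₂) I₁ Prod.fst p w = 0 := hw
  rw [hW.metric, hv', hw', inner_zero_left, inner_zero_right, mul_zero, add_zero]

theorem IsWarpedProductSubmanifold.inner_self (hW : IsWarpedProductSubmanifold I I₁ I₂ ι f)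
    {p : M₁ × M₂} {w : TangentSpace (I₁.prod I₂) p} (hw : w ∈ tangentSnd I₁ I₂ p) :
    inner ℝ (mfderiv (I₁.prod I₂) I ι p w) (mfderiv (I₁.prod I₂) I ι p w) =
      f p.1 ^ 2 * inner ℝ (mfderiv (I₁.prod I₂) I₂ Prod.snd p w)
        (mfderiv (I₁.prod I₂) I₂ Prod.snd p w) := by
  have hw' : mfderiv (I₁.prod I₂) I₁ Prod.fst p w = 0 := hw
  rw [hW.metric, hw', inner_zero_left, zero_add]

theorem IsWarpedProductSubmanifold.mdifferentiableAt_log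
    (hW : IsWarpedProductSubmanifold I I₁ I₂ ι f) (p : M₁ × M₂) :
    MDifferentiableAt (I₁.prod I₂) 𝓘(ℝ) (fun q : M₁ × M₂ ↦ Real.log (f q.1)) p := by
  have h1 : MDifferentiableAt (I₁.prod I₂) 𝓘(ℝ) (fun q : M₁ × M₂ ↦ f q.1) p :=
    ((hW.contMDiff_f.mdifferentiable (by simp)) p.1).comp p mdifferentiableAt_fst
  exact DifferentiableAt.comp_mdifferentiableAt (f := fun q : M₁ × M₂ ↦ f q.1)
    (Real.differentiableAt_log (hW.pos p.1).ne') h1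

variable [FiniteDimensional ℝ E] [I.Boundaryless] [I₁.Boundaryless] [I₂.Boundaryless]
  [IsManifold I ∞ N] [IsManifold I₁ ∞ M₁] [IsManifold I₂ ∞ M₂]
  [IsContMDiffRiemannianBundle I ∞ E (fun x : N ↦ TangentSpace I x)]

/-- In a warped product submanifold, `g(∇_w X, w) = X(ln f) g(w, w)` for a vector field `X` of the
ambient manifold that is tangent to the first factor along the submanifold and a vector `w` tangent
to the second factor. The field `X` may depend on the point of the second factor. -/
theorem IsWarpedProductSubmanifold.inner_leviCivita_self
    (hW : IsWarpedProductSubmanifold I I₁ I₂ ι f) {X : Π x : N, TangentSpace I x}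
    {p : M₁ × M₂} (hX : MDiffAt (T% X) (ι p)) (hXt : ∀ q, X (ι q) ∈ tangentFstImage I I₁ I₂ ι q)
    {v w : TangentSpace (I₁.prod I₂) p} (hv : mfderiv (I₁.prod I₂) I ι p v = X (ι p))
    (hw : w ∈ tangentSnd I₁ I₂ p) :
    inner ℝ (leviCivita I N X (ι p) (mfderiv (I₁.prod I₂) I ι p w))
        (mfderiv (I₁.prod I₂) I ι p w) =
      mvfderiv (I₁.prod I₂) (fun q : M₁ × M₂ ↦ Real.log (f q.1)) p v *
        inner ℝ (mfderiv (I₁.prod I₂) I ι p w) (mfderiv (I₁.prod I₂) I ι p w) := by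
  have hv2 : v.2 = 0 := by
    obtain ⟨x, hx, hx'⟩ := hXt p
    rw [hW.injective p (hv.trans hx'.symm)]
    exact mem_tangentFst_iff.1 hx
  have hw1 : w.1 = 0 := mem_tangentSnd_iff.1 hw
  obtain ⟨a, b⟩ := p
  obtain ⟨α, hα, rfl, hα'⟩ := exists_curve (I := I₁) a v.1
  obtain ⟨β, hβ, rfl, hβ'⟩ := exists_curve (I := I₂) b w.2
  -- `σ(s, t) = ι (α s, β t)`, where `α` and `β` have initial velocities `v` and `w`
  set c : ℝ × ℝ → M₁ × M₂ := fun q ↦ (α q.1, β q.2) with hc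
  set σ : ℝ × ℝ → N := fun q ↦ ι (c q) with hσ
  have hι : ∀ q, MDifferentiableAt (I₁.prod I₂) I ι q := hW.contMDiff.mdifferentiable (by simp)
  have hc0 : ContMDiffAt 𝓘(ℝ, ℝ × ℝ) (I₁.prod I₂) ∞ c (0, 0) :=
    (ContMDiffAt.comp (f := (Prod.fst : ℝ × ℝ → ℝ)) ((0 : ℝ), (0 : ℝ)) hα
      contDiff_fst.contMDiff.contMDiffAt).prodMk
    (ContMDiffAt.comp (f := (Prod.snd : ℝ × ℝ → ℝ)) ((0 : ℝ), (0 : ℝ)) hβ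
      contDiff_snd.contMDiff.contMDiffAt)
  have hα0 := hα.mdifferentiableAt (by simp)
  have hβ0 := hβ.mdifferentiableAt (by simp)
  have hcd : ∀ q : ℝ × ℝ, MDifferentiableAt 𝓘(ℝ) I₁ α q.1 → MDifferentiableAt 𝓘(ℝ) I₂ β q.2 →
      dFst (I₁.prod I₂) c q = (mfderiv 𝓘(ℝ) I₁ α q.1 (1 : ℝ), 0) ∧
      dSnd (I₁.prod I₂) c q = (0, mfderiv 𝓘(ℝ) I₂ β q.2 (1 : ℝ)) ∧
      dFst I σ q = mfderiv (I₁.prod I₂) I ι (c q) (dFst (I₁.prod I₂) c q) ∧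
      dSnd I σ q = mfderiv (I₁.prod I₂) I ι (c q) (dSnd (I₁.prod I₂) c q) := by
    intro q h1 h2
    refine ⟨(mfderiv_prodCurve h1 h2 (1, 0)).trans ?_, (mfderiv_prodCurve h1 h2 (0, 1)).trans ?_,
      mfderiv_comp_apply q (hι _) (mdifferentiableAt_prodCurve h1 h2) _,
      mfderiv_comp_apply q (hι _) (mdifferentiableAt_prodCurve h1 h2) _⟩
    · exact congrArg (Prod.mk _) (map_zero _)
    · exact congrArg (fun x : E₁ ↦ (x, _)) (map_zero (mfderiv 𝓘(ℝ) I₁ α q.1))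
  obtain ⟨k1, k2, k3, k4⟩ := hcd (0, 0) hα0 hβ0
  have k5 : dFst (I₁.prod I₂) c (0, 0) = v := k1.trans (Prod.ext hα' hv2.symm)
  have k6 : dSnd (I₁.prod I₂) c (0, 0) = w := k2.trans (Prod.ext hw1.symm hβ')
  have hαe : ∀ᶠ s in 𝓝 (0 : ℝ), MDifferentiableAt 𝓘(ℝ) I₁ α s := by
    filter_upwards [(contMDiffAt_iff_contMDiffAt_nhds (n := 1) (by simp)).1
      (hα.of_le (by simp))] with s hs using hs.mdifferentiableAt one_ne_zero
  have hβe : ∀ᶠ t in 𝓝 (0 : ℝ), MDifferentiableAt 𝓘(ℝ) I₂ β t := by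
    filter_upwards [(contMDiffAt_iff_contMDiffAt_nhds (n := 1) (by simp)).1
      (hβ.of_le (by simp))] with s hs using hs.mdifferentiableAt one_ne_zero
  have hσ2 : ContMDiffAt 𝓘(ℝ, ℝ × ℝ) I 2 σ (0, 0) :=
    ((hW.contMDiff (c (0, 0))).comp ((0 : ℝ), (0 : ℝ)) hc0).of_le ENat.LEInfty.out
  have main := hasDerivAt_inner_of_variation (σ := σ) (X := X) hσ2 hX
    (k3.trans ((congrArg _ k5).trans hv)) ?_
  · set ℓ : M₁ × M₂ → ℝ := fun q ↦ Real.log (f q.1) with hℓ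
    set K : ℝ := inner ℝ (mfderiv (I₁.prod I₂) I₂ Prod.snd (α 0, β 0) w)
      (mfderiv (I₁.prod I₂) I₂ Prod.snd (α 0, β 0) w) with hK
    have hlog : HasDerivAt (fun s : ℝ ↦ Real.log (f (α s)))
        (mvfderiv (I₁.prod I₂) ℓ (α 0, β 0) v) 0 := by
      have e1 := (hW.mdifferentiableAt_log (α 0, β 0)).comp
        (f := c) ((0 : ℝ), (0 : ℝ)) (hc0.mdifferentiableAt (by simp))
      have e2 : DifferentiableAt ℝ (ℓ ∘ c) (0, 0) := e1.differentiableAt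
      have e3 := e2.hasFDerivAt.comp_hasDerivAt (f := fun s : ℝ ↦ (s, (0 : ℝ))) (0 : ℝ)
        ((hasDerivAt_id (0 : ℝ)).prodMk (hasDerivAt_const _ _))
      refine e3.congr_deriv ?_
      have e4 := mfderiv_comp_apply ((0 : ℝ), (0 : ℝ))
        (hW.mdifferentiableAt_log (α 0, β 0))
        (hc0.mdifferentiableAt (by simp)) ((1, 0) : ℝ × ℝ)
      rw [mfderiv_eq_fderiv] at e4
      exact e4.trans (congrArg (mfderiv (I₁.prod I₂) 𝓘(ℝ) ℓ (α 0, β 0)) k5)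
    -- along `t = 0`, the squared norm of `∂ₜσ` is `f² K = exp (2 ln f) K`
    have hexp : HasDerivAt (fun s : ℝ ↦ Real.exp (2 * Real.log (f (α s))) * K)
        (Real.exp (2 * Real.log (f (α 0))) * (2 * mvfderiv (I₁.prod I₂) ℓ (α 0, β 0) v) * K) 0 :=
      ((hlog.const_mul 2).exp).mul_const K
    have hsq : ∀ a, Real.exp (2 * Real.log (f a)) = f a ^ 2 := fun a ↦ by
      rw [two_mul, Real.exp_add, Real.exp_log (hW.pos a), sq]
    have heq : ∀ᶠ s in 𝓝 (0 : ℝ), inner ℝ (dSnd I σ (s, 0)) (dSnd I σ (s, 0)) =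
        Real.exp (2 * Real.log (f (α s))) * K := by
      filter_upwards [hαe] with s hs
      obtain ⟨l1, l2, l3, l4⟩ := hcd (s, 0) hs hβ0
      have l5 : mfderiv (I₁.prod I₂) I₂ Prod.snd (c (s, 0)) (dSnd (I₁.prod I₂) c (s, 0)) =
          mfderiv (I₁.prod I₂) I₂ Prod.snd (α 0, β 0) w := by
        rw [mfderiv_snd, mfderiv_snd, l2]
        exact hβ'
      rw [l4, hW.inner_self (mem_tangentSnd_iff.2 (by rw [l2])), l5, hsq]
    have huniq := (main.congr_of_eventuallyEq (f₁ := fun s ↦ Real.exp (2 * Real.log (f (α s))) * K)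
      (heq.mono fun s hs ↦ hs.symm)).unique hexp
    have h0 := heq.self_of_nhds
    have k7 : dSnd I σ (0, 0) = mfderiv (I₁.prod I₂) I ι (α 0, β 0) w := k4.trans (congrArg _ k6)
    rw [k7] at huniq h0
    rw [h0]
    linarith
  -- both `X` and `∂ₛσ` are tangent to the first factor, and `∂ₜσ` to the second
  · filter_upwards [hβe] with t ht
    obtain ⟨l1, l2, l3, l4⟩ := hcd (0, t) hα0 ht
    obtain ⟨x, hx, hx'⟩ := hXt (c (0, t))
    have l5 : X (σ (0, t)) - dFst I σ (0, t) =
        mfderiv (I₁.prod I₂) I ι (c (0, t)) (x - dFst (I₁.prod I₂) c (0, t)) := by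
      rw [map_sub, l3]
      exact congrArg (· - _) hx'.symm
    rw [l5, l4]
    refine hW.inner_eq_zero (Submodule.sub_mem _ hx ?_) ?_
    · rw [mem_tangentFst_iff, l1]
    · rw [mem_tangentSnd_iff, l2]

end WarpedProductSubmanifold

end KenmotsuGeometry

end

theorem mainTheorem5 {m n₁ n₂ : ℕ} (hn₂ : 0 < n₂)
    -- the ambient Riemannian manifold `N`, of dimension `2 m + 1`
    {N : Type*} [TopologicalSpace N] [ChartedSpace (EuclideanSpace ℝ (Fin (2 * m + 1))) N]
    [IsManifold (𝓡 (2 * m + 1)) ∞ N]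
    [RiemannianBundle (fun x : N ↦ TangentSpace (𝓡 (2 * m + 1)) x)]
    [IsContMDiffRiemannianBundle (𝓡 (2 * m + 1)) ∞ (EuclideanSpace ℝ (Fin (2 * m + 1)))
      (fun x : N ↦ TangentSpace (𝓡 (2 * m + 1)) x)]
    -- its Kenmotsu structure
    (S : KenmotsuGeometry.AlmostContactMetricStructure (𝓡 (2 * m + 1)) N) (hS : S.IsKenmotsu)
    -- the Riemannian manifolds `M₁` and `M₂`
    {M₁ : Type*} [TopologicalSpace M₁] [ChartedSpace (EuclideanSpace ℝ (Fin n₁)) M₁]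
    [IsManifold (𝓡 n₁) ∞ M₁]
    [RiemannianBundle (fun x : M₁ ↦ TangentSpace (𝓡 n₁) x)]
    [IsContMDiffRiemannianBundle (𝓡 n₁) ∞ (EuclideanSpace ℝ (Fin n₁))
      (fun x : M₁ ↦ TangentSpace (𝓡 n₁) x)]
    {M₂ : Type*} [TopologicalSpace M₂] [ChartedSpace (EuclideanSpace ℝ (Fin n₂)) M₂]
    [IsManifold (𝓡 n₂) ∞ M₂]
    [RiemannianBundle (fun x : M₂ ↦ TangentSpace (𝓡 n₂) x)]
    [IsContMDiffRiemannianBundle (𝓡 n₂) ∞ (EuclideanSpace ℝ (Fin n₂))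
      (fun x : M₂ ↦ TangentSpace (𝓡 n₂) x)]
    -- the warped product pointwise bi-slant submanifold `ι : M₁ ×_f M₂ → N`
    (ι : M₁ × M₂ → N) (f : M₁ → ℝ)
    (D₁ D₂ : Π p : M₁ × M₂, Submodule ℝ (TangentSpace (𝓡 (2 * m + 1)) (ι p)))
    (θ₁ θ₂ : M₁ × M₂ → ℝ)
    (hM : KenmotsuGeometry.IsWarpedProductPointwiseBiSlant
      (𝓡 (2 * m + 1)) (𝓡 n₁) (𝓡 n₂) S ι f D₁ D₂ θ₁ θ₂)
    (hξ : ∀ p, S.ξ (ι p) ∈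
      KenmotsuGeometry.tangentFstImage (𝓡 (2 * m + 1)) (𝓡 n₁) (𝓡 n₂) ι p)
    (hproper : KenmotsuGeometry.IsProperPair θ₁ θ₂)
    (hmixed : KenmotsuGeometry.IsMixedTotallyGeodesic (𝓡 (2 * m + 1)) (𝓡 n₁) (𝓡 n₂) ι) :
    -- `v` is `ξ` regarded as a tangent vector of `M₁ × M₂`
    ∀ (p : M₁ × M₂) (v : TangentSpace ((𝓡 n₁).prod (𝓡 n₂)) p),
      mfderiv ((𝓡 n₁).prod (𝓡 n₂)) (𝓡 (2 * m + 1)) ι p v = S.ξ (ι p) →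
      mvfderiv ((𝓡 n₁).prod (𝓡 n₂)) (fun q : M₁ × M₂ ↦ Real.log (f q.1)) p v = 1 := by
  intro p v hv
  -- a nonzero vector tangent to `M₂` exists because `0 < n₂`
  obtain ⟨w₂, hw₂⟩ : ∃ w₂ : EuclideanSpace ℝ (Fin n₂), w₂ ≠ 0 := by
    have : Nonempty (Fin n₂) := ⟨⟨0, hn₂⟩⟩
    exact exists_ne 0
  set w : TangentSpace ((𝓡 n₁).prod (𝓡 n₂)) p := ((0, w₂) :
    EuclideanSpace ℝ (Fin n₁) × EuclideanSpace ℝ (Fin n₂)) with hw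
  have hwt : w ∈ KenmotsuGeometry.tangentSnd (𝓡 n₁) (𝓡 n₂) p :=
    KenmotsuGeometry.mem_tangentSnd_iff.2 rfl
  set u := mfderiv ((𝓡 n₁).prod (𝓡 n₂)) (𝓡 (2 * m + 1)) ι p w with hu
  have hu0 : u ≠ 0 := fun h ↦ hw₂ (congrArg Prod.snd
    (hM.warped.injective p (h.trans (map_zero _).symm) : w = 0))
  have hη : S.η (ι p) u = 0 := by
    obtain ⟨x, hx, hx'⟩ := hξ p
    rw [S.η_eq, real_inner_comm, ← hx']
    exact hM.warped.inner_eq_zero hx hwt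
  have key := hM.warped.inner_leviCivita_self
    ((S.contMDiff_ξ (ι p)).mdifferentiableAt (by simp)) hξ hv hwt
  rw [hS.nabla_ξ, hη, zero_smul, sub_zero] at key
  exact (mul_eq_right₀ (inner_self_ne_zero.2 hu0)).1 key.symm
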